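/- **Conventions.** A QL-algebra is an algebra of the propositional quantum logic FS of Faggian and Sambin (orthologic), i.e. an ortholattice $(\Omega,\wedge,\vee,0,1,(-)^\perp)$; $\mathbf{QL}$ is the category of QL-algebras and homomorphisms. A QL-hyperdoctrine is a functor $P:\mathbf C^{\rm op}\to\mathbf{QL}$, where $\mathbf C$ has finite products; it has quantifiers if, for all projections $\pi:X\times Y\to Y$, the map $P(\pi)$ has a right adjoint $\forall_\pi$ and a left adjoint $\exists_\pi$ (with respect to the lattice orders), both satisfying the Beck–Chevalley condition with respect to every $f:Z\to Y$. For a complete QL-algebra $\Omega$, the set-based duality QL-hyperdoctrine is $\mathrm{Hom}(-,\Omega):\mathbf{Set}^{\rm op}\to\mathbf{QL}$ with pointwise operations; its quantifiers are pointwise meets and joins. The calculus $\mathrm{TFS}^q$ is Faggian–Sambin's sequent calculus with quantifiers over a many-sorted signature. Formulas-in-context $A\,[\Gamma]$, with $\Gamma=x_1:\sigma_1,\dots,x_n:\sigma_n$, are built from atoms $R(\vec t)$ and negated atoms $R(\vec t)^\perp$ by $\top,0,\mathbin{\&},\oplus,\forall x{:}\sigma,\exists x{:}\sigma$; negation $A^\perp$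 is defined by De Morgan duality. Sequents-in-context are $\Phi\vdash\Psi\,[\Gamma]$ with $\Phi,\Psi$ finite lists of formulas in context $\Gamma$. The rules are: identity; substitution of terms for variables; the cuts $$\frac{\Phi\vdash A\quad A,\Phi'\vdash\Psi}{\Phi,\Phi'\vdash\Psi}\qquad\frac{\Phi\vdash A,\Psi'\quad A\vdash\Psi}{\Phi\vdash\Psi,\Psi'}\,;$$ exchange, weakening and contraction on both sides; from $\Phi\vdash\Psi$ infer $\Phi,\Psi^\perp\vdash$ and $\vdash\Phi^\perp,\Psi$ and $\Psi^\perp\vdash\Phi^\perp$; the axioms $\Phi\vdash\top$ and $0\vdash\Psi$; and the usual left and right rules for $\mathbin{\&},\oplus,\forall,\exists$ in which the active formulas stand alone on their side of the sequent. An interpretation of the signature in $P$ sends each type $\sigma$ to an object $[\![\sigma]\!]$ of $\mathbf C$, contexts to finite products, function symbols to arrows, and predicate symbols $R$ of arity $\sigma_1,\dots,\sigma_n$ to elements of $P([\![\sigma_1]\!]\times\cdots\times[\![\sigma_n]\!])$; terms and formulas are then interpreted in the standard way, quantifiers by $\forall_\pi$ and $\exists_\pi$. It satisfies $\Phi\vdash\Psi\,[\Gamma]$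 if $\bigwedge[\![\Phi]\!]\le\bigvee[\![\Psi]\!]$ in $P([\![\Gamma]\!])$. **Theorem.** The class of all set-based duality QL-hyperdoctrines $\mathrm{Hom}(-,\Omega):\mathbf{Set}^{\rm op}\to\mathbf{QL}$, with $\Omega$ ranging over the complete QL-algebras, gives sound and complete semantics for $\mathrm{TFS}^q$. Precisely, let $T$ be any set of sequents-in-context over a signature (for instance $T=\emptyset$), and let $\Phi\vdash\Psi\,[\Gamma]$ be a sequent-in-context. 1. (Soundness) If $\Phi\vdash\Psi\,[\Gamma]$ is derivable in $\mathrm{TFS}^q$ from the axioms $T$, then it is satisfied by every interpretation, in every $\mathrm{Hom}(-,\Omega)$ with $\Omega$ a complete QL-algebra, that satisfies all the sequents in $T$. 2. (Completeness) Suppose that for each type $\sigma$ of the signature there is a term $t:\sigma\,[\Gamma]$. If $\Phi\vdash\Psi\,[\Gamma]$ is satisfied by every such interpretation, then it is derivable in $\mathrm{TFS}^q$ from $T$. -/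

import Mathlib

open CategoryTheory MonoidalCategory CartesianMonoidalCategory Opposite

universe u v w

namespace TFSq

/-! ## QL-algebras -/

/-- Algebras of the propositional quantum logic FS (orthologic): ortholattices, that is bounded
lattices with an antitone involution `ᶜ` such that `a ⊓ aᶜ = ⊥` (hence also `a ⊔ aᶜ = ⊤`).
The deducibility ordering is the lattice order. -/
class Ortholattice (α : Type u) extends Lattice α, BoundedOrder α, Compl α where
  compl_anti : ∀ a b : α, a ≤ b → bᶜ ≤ aᶜ
  compl_invol : ∀ a : α, aᶜᶜ = a
  inf_compl_self : ∀ a : α, a ⊓ aᶜ = ⊥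

/-- Homomorphisms of QL-algebras preserve all the operations. -/
@[ext]
structure OrthoHom (α : Type u) (β : Type v) [Ortholattice α] [Ortholattice β] where
  toFun : α → β
  map_inf : ∀ a b, toFun (a ⊓ b) = toFun a ⊓ toFun b
  map_sup : ∀ a b, toFun (a ⊔ b) = toFun a ⊔ toFun b
  map_top : toFun ⊤ = ⊤
  map_bot : toFun ⊥ = ⊥
  map_compl : ∀ a, toFun aᶜ = (toFun a)ᶜ

/-- Objects of the category **QL**. -/
structure QL : Type (u + 1) where
  carrier : Type u
  [str : Ortholattice carrier]

attribute [instance] QL.str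

instance : CoeSort QL.{u} (Type u) := ⟨QL.carrier⟩

/-- The category **QL**. -/
instance : Category.{u} QL.{u} where
  Hom A B := OrthoHom A B
  id A := ⟨fun a => a, fun _ _ => rfl, fun _ _ => rfl, rfl, rfl, fun _ => rfl⟩
  comp f g :=
    { toFun := fun a => g.toFun (f.toFun a)
      map_inf := fun a b => by rw [f.map_inf, g.map_inf]
      map_sup := fun a b => by rw [f.map_sup, g.map_sup]
      map_top := by rw [f.map_top, g.map_top]
      map_bot := by rw [f.map_bot, g.map_bot]
      map_compl := fun a => by rw [f.map_compl, g.map_compl] }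

/-- A QL-algebra is complete if every subset has a least upper bound
(and hence also a greatest lower bound). -/
def QL.IsComplete (Ω : QL.{u}) : Prop := ∀ s : Set Ω, ∃ a, IsLUB s a

theorem QL.IsComplete.exists_isGLB {Ω : QL.{u}} (h : Ω.IsComplete) (s : Set Ω) :
    ∃ a, IsGLB s a := by
  obtain ⟨a, ha⟩ := h (lowerBounds s)
  exact ⟨a, isLUB_lowerBounds.mp ha⟩

/-! ## QL-hyperdoctrines -/

/-- A QL-hyperdoctrine over a category with finite products: a QL-valued presheaf. -/
abbrev Hyperdoctrine (C : Type v) [Category.{w} C] [CartesianMonoidalCategory C] :=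
  Cᵒᵖ ⥤ QL.{u}

section Hyperdoctrine

variable {C : Type v} [Category.{w} C] [CartesianMonoidalCategory C]

/-- The fibre of `P` over `X`. -/
abbrev Fibre (P : Hyperdoctrine.{u} C) (X : C) : Type u := (P.obj (op X)).carrier

/-- The pullback `P(f)` along an arrow `f` of the base. -/
def pull (P : Hyperdoctrine.{u} C) {X Y : C} (f : X ⟶ Y) : Fibre P Y → Fibre P X :=
  OrthoHom.toFun (P.map f.op)

/-- Universal and existential quantifiers of a hyperdoctrine: right and left adjoints to the
pullbacks along the projections `π : X × Y → Y`, with the Beck-Chevalley conditions.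
(Adjoints between posets are unique, so this is a property of `P`.) -/
structure Quantifiers (P : Hyperdoctrine.{u} C) where
  all : ∀ X Y : C, Fibre P (X ⊗ Y) → Fibre P Y
  all_adj : ∀ X Y : C, GaloisConnection (pull P (snd X Y)) (all X Y)
  all_beckChevalley : ∀ (X : C) {Y Z : C} (f : Z ⟶ Y) (a : Fibre P (X ⊗ Y)),
    pull P f (all X Y a) = all X Z (pull P (X ◁ f) a)
  ex : ∀ X Y : C, Fibre P (X ⊗ Y) → Fibre P Y
  ex_adj : ∀ X Y : C, GaloisConnection (ex X Y) (pull P (snd X Y))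
  ex_beckChevalley : ∀ (X : C) {Y Z : C} (f : Z ⟶ Y) (a : Fibre P (X ⊗ Y)),
    pull P f (ex X Y a) = ex X Z (pull P (X ◁ f) a)

end Hyperdoctrine

/-! ## Set-based duality hyperdoctrines -/

/-- The set of functions `X → Ω`, with the pointwise operations. -/
instance pointwise (X : Type v) (Ω : Type u) [Ortholattice Ω] : Ortholattice (X → Ω) where
  compl_anti := fun _ _ h x => Ortholattice.compl_anti _ _ (h x)
  compl_invol := fun a => funext fun x => Ortholattice.compl_invol (a x)
  inf_compl_self := fun a => funext fun x => Ortholattice.inf_compl_self (a x)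

/-- The set-based duality hyperdoctrine `Hom(-, Ω) : Setᵒᵖ ⥤ QL`. -/
def homDoctrine (Ω : QL.{u}) : Hyperdoctrine.{u} (Type u) where
  obj X := ⟨X.unop → Ω⟩
  map {X Y} f :=
    ({ toFun := fun v y => v (f.unop y)
       map_inf := fun _ _ => rfl
       map_sup := fun _ _ => rfl
       map_top := rfl
       map_bot := rfl
       map_compl := fun _ => rfl } : OrthoHom (X.unop → Ω) (Y.unop → Ω))
  map_id _ := rfl
  map_comp _ _ := rfl

/-- For complete `Ω`, the quantifiers of `Hom(-, Ω)` are pointwise meets and joins: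
`(∀ v)(y) = ⋀ {v (x, y) | x ∈ X}` and `(∃ v)(y) = ⋁ {v (x, y) | x ∈ X}`. -/
noncomputable def homQuantifiers (Ω : QL.{u}) (h : Ω.IsComplete) :
    Quantifiers (homDoctrine Ω) where
  all X Y v := fun y : Y => (h.exists_isGLB (Set.range fun x : X => v (x, y))).choose
  all_adj X Y a v := by
    constructor
    · intro hav y
      refine (h.exists_isGLB (Set.range fun x : X => v (x, y))).choose_spec.2 ?_
      rintro _ ⟨x, rfl⟩
      exact hav (x, y)
    · intro hav p
      refine le_trans (hav p.2) ?_
      exact (h.exists_isGLB (Set.range fun x : X => v (x, p.2))).choose_spec.1 ⟨p.1, rfl⟩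
  all_beckChevalley _ _ _ _ _ := rfl
  ex X Y v := fun y : Y => (h (Set.range fun x : X => v (x, y))).choose
  ex_adj X Y v a := by
    constructor
    · intro hav p
      refine le_trans ?_ (hav p.2)
      exact (h (Set.range fun x : X => v (x, p.2))).choose_spec.1 ⟨p.1, rfl⟩
    · intro hav y
      refine (h (Set.range fun x : X => v (x, y))).choose_spec.2 ?_
      rintro _ ⟨x, rfl⟩
      exact hav (x, y)
  ex_beckChevalley _ _ _ _ _ := rfl

/-! ## Typed syntax -/

/-- A many-sorted signature: basic types, typed function symbols and typed predicate symbols. -/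
structure Signature : Type (u + 1) where
  Ty : Type u
  Fn : Type u
  dom : Fn → List Ty
  cod : Fn → Ty
  Rel : Type u
  arity : Rel → List Ty

/-- A type context: a finite list of types, the types of its (nameless) variables. -/
abbrev Ctx (S : Signature.{u}) : Type u := List S.Ty

/-- The variables of type `σ` in a context, as de Bruijn indices. -/
inductive Var {S : Signature.{u}} : Ctx S → S.Ty → Type u
  | zero {Γ : Ctx S} {σ : S.Ty} : Var (σ :: Γ) σ
  | succ {Γ : Ctx S} {σ τ : S.Ty} : Var Γ σ → Var (τ :: Γ) σ

/-- Terms-in-context `t : σ [Γ]`. -/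
inductive Term {S : Signature.{u}} (Γ : Ctx S) : S.Ty → Type u
  | var {σ : S.Ty} : Var Γ σ → Term Γ σ
  | app (f : S.Fn) : (∀ σ : S.Ty, Var (S.dom f) σ → Term Γ σ) → Term Γ (S.cod f)

/-- A substitution: a term in context `Γ` for each variable of `Δ`. -/
abbrev Subst {S : Signature.{u}} (Γ Δ : Ctx S) : Type u := ∀ σ : S.Ty, Var Δ σ → Term Γ σ

/-- Formulas-in-context. As in Faggian and Sambin's calculus, negation is primitive on atoms and
is extended to all formulas by duality (`Formula.neg`). -/
inductive Formula {S : Signature.{u}} : Ctx S → Type u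
  | rel {Γ : Ctx S} (R : S.Rel) (ts : Subst Γ (S.arity R)) : Formula Γ
  | nrel {Γ : Ctx S} (R : S.Rel) (ts : Subst Γ (S.arity R)) : Formula Γ
  | top {Γ : Ctx S} : Formula Γ
  | bot {Γ : Ctx S} : Formula Γ
  | and {Γ : Ctx S} : Formula Γ → Formula Γ → Formula Γ
  | or {Γ : Ctx S} : Formula Γ → Formula Γ → Formula Γ
  | all {Γ : Ctx S} (σ : S.Ty) : Formula (σ :: Γ) → Formula Γ
  | ex {Γ : Ctx S} (σ : S.Ty) : Formula (σ :: Γ) → Formula Γ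

section Substitution

variable {S : Signature.{u}}

/-- The negation `A^⊥`. -/
def Formula.neg : {Γ : Ctx S} → Formula Γ → Formula Γ
  | _, .rel R ts => .nrel R ts
  | _, .nrel R ts => .rel R ts
  | _, .top => .bot
  | _, .bot => .top
  | _, .and A B => .or A.neg B.neg
  | _, .or A B => .and A.neg B.neg
  | _, .all σ A => .ex σ A.neg
  | _, .ex σ A => .all σ A.neg

/-- Renaming of variables in a term. -/
def Term.rename {Γ Δ : Ctx S} (ρ : ∀ σ : S.Ty, Var Δ σ → Var Γ σ) :
    {σ : S.Ty} → Term Δ σ → Term Γ σ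
  | _, .var x => .var (ρ _ x)
  | _, .app f ts => .app f fun τ x => (ts τ x).rename ρ

/-- Substitution in a term. -/
def Term.subst {Γ Δ : Ctx S} (s : Subst Γ Δ) : {σ : S.Ty} → Term Δ σ → Term Γ σ
  | _, .var x => s _ x
  | _, .app f ts => .app f fun τ x => (ts τ x).subst s

/-- Passage of a substitution under a binder. -/
def Subst.lift {Γ Δ : Ctx S} (τ : S.Ty) (s : Subst Γ Δ) : Subst (τ :: Γ) (τ :: Δ)
  | _, .zero => .var .zero
  | _, .succ x => (s _ x).rename fun _ => Var.succ

/-- Capture-avoiding substitution in a formula. -/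
def Formula.subst : {Γ Δ : Ctx S} → Subst Γ Δ → Formula Δ → Formula Γ
  | _, _, s, .rel R ts => .rel R fun τ x => (ts τ x).subst s
  | _, _, s, .nrel R ts => .nrel R fun τ x => (ts τ x).subst s
  | _, _, _, .top => .top
  | _, _, _, .bot => .bot
  | _, _, s, .and A B => .and (A.subst s) (B.subst s)
  | _, _, s, .or A B => .or (A.subst s) (B.subst s)
  | _, _, s, .all σ A => .all σ (A.subst (s.lift σ))
  | _, _, s, .ex σ A => .ex σ (A.subst (s.lift σ))

/-- The substitution adding an unused variable to the context. -/
def Subst.weaken (σ : S.Ty) (Γ : Ctx S) : Subst (σ :: Γ) Γ := fun _ x => .var (.succ x)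

/-- The substitution of `t` for the first variable. -/
def Subst.single {Γ : Ctx S} {σ : S.Ty} (t : Term Γ σ) : Subst Γ (σ :: Γ)
  | _, .zero => t
  | _, .succ x => .var x

/-- `A` in the context enlarged by an unused variable. -/
def Formula.weaken {Γ : Ctx S} (σ : S.Ty) (A : Formula Γ) : Formula (σ :: Γ) :=
  A.subst (Subst.weaken σ Γ)

/-- `A[t/x]`, where `x` is the first variable of the context of `A`. -/
def Formula.inst {Γ : Ctx S} {σ : S.Ty} (A : Formula (σ :: Γ)) (t : Term Γ σ) : Formula Γ :=
  A.subst (Subst.single t)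

end Substitution

/-- A sequent-in-context `Φ ⊢ Ψ [Γ]`. -/
structure Sequent (S : Signature.{u}) : Type u where
  ctx : Ctx S
  ant : List (Formula ctx)
  suc : List (Formula ctx)

/-- The typed quantum sequent calculus `TFS^q`, with a set `T` of additional axioms:
`Derives T Γ Φ Ψ` says that `Φ ⊢ Ψ [Γ]` is derivable from `T`. In all operational rules the
active formulas have no context on their own side (visibility). -/
inductive Derives {S : Signature.{u}} (T : Set (Sequent S)) :
    (Γ : Ctx S) → List (Formula Γ) → List (Formula Γ) → Prop
  | ofAxiom (s : Sequent S) : s ∈ T → Derives T s.ctx s.ant s.suc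
  | identity {Γ : Ctx S} (A : Formula Γ) : Derives T Γ [A] [A]
  -- substitution of terms for variables
  | substitution {Γ Δ : Ctx S} {Φ Ψ : List (Formula Δ)} (s : Subst Γ Δ) :
      Derives T Δ Φ Ψ → Derives T Γ (Φ.map (Formula.subst s)) (Ψ.map (Formula.subst s))
  -- cut
  | cutL {Γ : Ctx S} {Φ Φ' Ψ : List (Formula Γ)} {A : Formula Γ} :
      Derives T Γ Φ [A] → Derives T Γ (A :: Φ') Ψ → Derives T Γ (Φ ++ Φ') Ψ
  | cutR {Γ : Ctx S} {Φ Ψ Ψ' : List (Formula Γ)} {A : Formula Γ} :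
      Derives T Γ Φ (A :: Ψ') → Derives T Γ [A] Ψ → Derives T Γ Φ (Ψ ++ Ψ')
  -- exchange, weakening, contraction
  | exchange {Γ : Ctx S} {Φ Φ' Ψ Ψ' : List (Formula Γ)} :
      Φ.Perm Φ' → Ψ.Perm Ψ' → Derives T Γ Φ Ψ → Derives T Γ Φ' Ψ'
  | weakL {Γ : Ctx S} {Φ Ψ : List (Formula Γ)} (A : Formula Γ) :
      Derives T Γ Φ Ψ → Derives T Γ (A :: Φ) Ψ
  | weakR {Γ : Ctx S} {Φ Ψ : List (Formula Γ)} (A : Formula Γ) :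
      Derives T Γ Φ Ψ → Derives T Γ Φ (A :: Ψ)
  | contrL {Γ : Ctx S} {Φ Ψ : List (Formula Γ)} {A : Formula Γ} :
      Derives T Γ (A :: A :: Φ) Ψ → Derives T Γ (A :: Φ) Ψ
  | contrR {Γ : Ctx S} {Φ Ψ : List (Formula Γ)} {A : Formula Γ} :
      Derives T Γ Φ (A :: A :: Ψ) → Derives T Γ Φ (A :: Ψ)
  -- negation: transfer of a whole side, and contraposition
  | transferL {Γ : Ctx S} {Φ Ψ : List (Formula Γ)} :
      Derives T Γ Φ Ψ → Derives T Γ (Φ ++ Ψ.map Formula.neg) []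
  | transferR {Γ : Ctx S} {Φ Ψ : List (Formula Γ)} :
      Derives T Γ Φ Ψ → Derives T Γ [] (Φ.map Formula.neg ++ Ψ)
  | contraposition {Γ : Ctx S} {Φ Ψ : List (Formula Γ)} :
      Derives T Γ Φ Ψ → Derives T Γ (Ψ.map Formula.neg) (Φ.map Formula.neg)
  -- constants
  | topR {Γ : Ctx S} (Φ : List (Formula Γ)) : Derives T Γ Φ [.top]
  | botL {Γ : Ctx S} (Ψ : List (Formula Γ)) : Derives T Γ [.bot] Ψ
  -- conjunction
  | andL₁ {Γ : Ctx S} {Ψ : List (Formula Γ)} {A : Formula Γ} (B : Formula Γ) :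
      Derives T Γ [A] Ψ → Derives T Γ [.and A B] Ψ
  | andL₂ {Γ : Ctx S} {Ψ : List (Formula Γ)} (A : Formula Γ) {B : Formula Γ} :
      Derives T Γ [B] Ψ → Derives T Γ [.and A B] Ψ
  | andR {Γ : Ctx S} {Φ : List (Formula Γ)} {A B : Formula Γ} :
      Derives T Γ Φ [A] → Derives T Γ Φ [B] → Derives T Γ Φ [.and A B]
  -- disjunction
  | orL {Γ : Ctx S} {Ψ : List (Formula Γ)} {A B : Formula Γ} :
      Derives T Γ [A] Ψ → Derives T Γ [B] Ψ → Derives T Γ [.or A B] Ψ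
  | orR₁ {Γ : Ctx S} {Φ : List (Formula Γ)} {A : Formula Γ} (B : Formula Γ) :
      Derives T Γ Φ [A] → Derives T Γ Φ [.or A B]
  | orR₂ {Γ : Ctx S} {Φ : List (Formula Γ)} (A : Formula Γ) {B : Formula Γ} :
      Derives T Γ Φ [B] → Derives T Γ Φ [.or A B]
  -- quantifiers
  | allL {Γ : Ctx S} {Ψ : List (Formula Γ)} {σ : S.Ty} {A : Formula (σ :: Γ)} (t : Term Γ σ) :
      Derives T Γ [A.inst t] Ψ → Derives T Γ [.all σ A] Ψ
  | allR {Γ : Ctx S} {Φ : List (Formula Γ)} {σ : S.Ty} {A : Formula (σ :: Γ)} :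
      Derives T (σ :: Γ) (Φ.map (Formula.weaken σ)) [A] → Derives T Γ Φ [.all σ A]
  | exL {Γ : Ctx S} {Ψ : List (Formula Γ)} {σ : S.Ty} {A : Formula (σ :: Γ)} :
      Derives T (σ :: Γ) [A] (Ψ.map (Formula.weaken σ)) → Derives T Γ [.ex σ A] Ψ
  | exR {Γ : Ctx S} {Φ : List (Formula Γ)} {σ : S.Ty} {A : Formula (σ :: Γ)} (t : Term Γ σ) :
      Derives T Γ Φ [A.inst t] → Derives T Γ Φ [.ex σ A]

/-- The sequent `s` is derivable in `TFS^q` from the axioms `T`. -/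
def Derivable {S : Signature.{u}} (T : Set (Sequent S)) (s : Sequent S) : Prop :=
  Derives T s.ctx s.ant s.suc

/-! ## Interpretation in hyperdoctrines -/

section Semantics

variable {S : Signature.{u}} {C : Type v} [Category.{w} C] [CartesianMonoidalCategory C]

/-- The interpretation of a context: the product of the interpretations of its types. -/
def ctxObj (ty : S.Ty → C) : Ctx S → C
  | [] => 𝟙_ C
  | σ :: Γ => ty σ ⊗ ctxObj ty Γ

/-- Variables are interpreted as projections. -/
def varHom (ty : S.Ty → C) : {Γ : Ctx S} → {σ : S.Ty} → Var Γ σ → (ctxObj ty Γ ⟶ ty σ)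
  | _, _, .zero => fst _ _
  | _, _, .succ x => snd _ _ ≫ varHom ty x

/-- The arrow into (the interpretation of) a context with given components. -/
def tuple (ty : S.Ty → C) {X : C} :
    (Δ : Ctx S) → (∀ σ : S.Ty, Var Δ σ → (X ⟶ ty σ)) → (X ⟶ ctxObj ty Δ)
  | [], _ => toUnit X
  | σ :: Δ, g => lift (g σ .zero) (tuple ty Δ fun τ x => g τ (.succ x))

/-- An interpretation of the signature `S` in the hyperdoctrine `P`. -/
structure Interpretation (S : Signature.{u}) (P : Hyperdoctrine.{u} C) where
  ty : S.Ty → C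
  fn : ∀ f : S.Fn, ctxObj ty (S.dom f) ⟶ ty (S.cod f)
  rel : ∀ R : S.Rel, Fibre P (ctxObj ty (S.arity R))

namespace Interpretation

variable {P : Hyperdoctrine.{u} C}

/-- `⟦t⟧ : ⟦Γ⟧ ⟶ ⟦σ⟧` for a term `t : σ [Γ]`. -/
def term (I : Interpretation S P) {Γ : Ctx S} :
    {σ : S.Ty} → Term Γ σ → (ctxObj I.ty Γ ⟶ I.ty σ)
  | _, .var x => varHom I.ty x
  | _, .app f ts => tuple I.ty (S.dom f) (fun τ x => I.term (ts τ x)) ≫ I.fn f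

/-- `⟦A⟧ ∈ P(⟦Γ⟧)` for a formula `A [Γ]`. -/
def formula (Q : Quantifiers P) (I : Interpretation S P) :
    {Γ : Ctx S} → Formula Γ → Fibre P (ctxObj I.ty Γ)
  | _, .rel R ts => pull P (tuple I.ty (S.arity R) fun τ x => I.term (ts τ x)) (I.rel R)
  | _, .nrel R ts => (pull P (tuple I.ty (S.arity R) fun τ x => I.term (ts τ x)) (I.rel R))ᶜ
  | _, .top => ⊤
  | _, .bot => ⊥
  | _, .and A B => I.formula Q A ⊓ I.formula Q B
  | _, .or A B => I.formula Q A ⊔ I.formula Q B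
  | Γ, .all σ A => Q.all (I.ty σ) (ctxObj I.ty Γ) (I.formula Q A)
  | Γ, .ex σ A => Q.ex (I.ty σ) (ctxObj I.ty Γ) (I.formula Q A)

/-- `Φ ⊢ Ψ [Γ]` is satisfied if `⋀ ⟦Φ⟧ ≤ ⋁ ⟦Ψ⟧` in the fibre `P(⟦Γ⟧)`. -/
def Satisfies (Q : Quantifiers P) (I : Interpretation S P) (s : Sequent S) : Prop :=
  s.ant.foldr (fun A a => I.formula Q A ⊓ a) ⊤ ≤ s.suc.foldr (fun A a => I.formula Q A ⊔ a) ⊥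

end Interpretation

end Semantics

/-- `s` holds in every set-based duality hyperdoctrine `Hom(-, Ω)`, for `Ω` a complete QL-algebra,
under every interpretation satisfying all the axioms `T`. -/
def SetValid {S : Signature.{u}} (T : Set (Sequent S)) (s : Sequent S) : Prop :=
  ∀ (Ω : QL.{u}) (hΩ : Ω.IsComplete) (I : Interpretation S (homDoctrine Ω)),
    (∀ t ∈ T, I.Satisfies (homQuantifiers Ω hΩ) t) → I.Satisfies (homQuantifiers Ω hΩ) s

end TFSq

/-!
Soundness holds in every hyperdoctrine with quantifiers. Substitution is interpreted by pullback
(`Interpretation.formula_subst`), the quantifier case being the Beck-Chevalley condition; defined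
negation is interpreted by the orthocomplement (`Interpretation.formula_neg`), because the
orthocomplement interchanges the two adjoints of a pullback; each rule is then an inequality in an
ortholattice (`Derives.sound`).

For completeness, let `Γ` be the context of the sequent, and adjoin to it countably many variables
of each type. The canonical interpretation has as elements of type `σ` the terms of type `σ` over
these variables. Its algebra `Ω` is the MacNeille completion of the Lindenbaum algebra of formulas
over these variables, realised as the sets of formulas equal to their double orthocomplement, where
`A` is orthogonal to `B` if `A ⊢ B^⊥`; that this relation yields an ortholattice is exactly what the
negation rules give. The embedding `down` of the Lindenbaum algebra preserves all operations, and
it sends `∀ x, A` to the meet of the images of the `A[t/x]`: a formula that implies every `A[t/x]`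
implies `A[y/x]` for a variable `y` fresh for both, hence implies `∀ x, A` (`isGLB_down_all`).
Existential quantifiers follow by negation. So a sequent holds in the canonical interpretation if
and only if all its instances are derivable (`canonical_satisfies_iff`). The axioms hold since the
calculus has a substitution rule. If the given sequent holds, its generic instance is derivable over
`Γ` and the additional variables, and replacing these by terms over `Γ` gives a derivation over
`Γ`. This is the only use of the hypothesis that every type has a term over `Γ`.

Contexts being finite lists, formulas with infinitely many possible variables are not formulas in a
context. They are encoded by `Family`: a formula over `Γ` and the additional variables is the
collection of its instances, in all contexts and under all assignments of terms to the variables;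
these commute with substitution and depend only on the additional variables of index below some
bound.
-/

namespace TFSq

/-! ### Substitution -/

section SubstitutionLemmas

variable {S : Signature.{u}}

/-- The identity substitution. -/
def Subst.id (Γ : Ctx S) : Subst Γ Γ := fun _ x => .var x

/-- The substitution `s` followed by `r`. -/
def Subst.comp {Γ Δ Θ : Ctx S} (s : Subst Δ Θ) (r : Subst Γ Δ) : Subst Γ Θ :=
  fun σ x => (s σ x).subst r

/-- The extension of a substitution by a term for a new first variable. -/
def Subst.cons {Γ Δ : Ctx S} {σ : S.Ty} (t : Term Γ σ) (s : Subst Γ Δ) : Subst Γ (σ :: Δ)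
  | _, .zero => t
  | _, .succ x => s _ x

theorem Term.rename_eq_subst {Γ Δ : Ctx S} (ρ : ∀ σ : S.Ty, Var Δ σ → Var Γ σ) {σ : S.Ty}
    (t : Term Δ σ) : t.rename ρ = t.subst fun σ x => .var (ρ σ x) := by
  induction t with
  | var x => rfl
  | app f ts ih => simp only [Term.rename, Term.subst, ih]

theorem Term.subst_id {Γ : Ctx S} {σ : S.Ty} (t : Term Γ σ) : t.subst (Subst.id Γ) = t := by
  induction t with
  | var x => rfl
  | app f ts ih => simp only [Term.subst, ih]

theorem Term.subst_subst {Γ Δ Θ : Ctx S} (s : Subst Δ Θ) (r : Subst Γ Δ) {σ : S.Ty}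
    (t : Term Θ σ) : (t.subst s).subst r = t.subst (s.comp r) := by
  induction t with
  | var x => rfl
  | app f ts ih => simp only [Term.subst, ih]

theorem Subst.lift_eq_cons {Γ Δ : Ctx S} (τ : S.Ty) (s : Subst Γ Δ) :
    s.lift τ = Subst.cons (.var .zero) (s.comp (Subst.weaken τ Γ)) := by
  funext σ x
  cases x with
  | zero => rfl
  | succ x => exact Term.rename_eq_subst _ _

theorem Subst.lift_id (Γ : Ctx S) (τ : S.Ty) : (Subst.id Γ).lift τ = Subst.id (τ :: Γ) := by
  funext σ x
  cases x <;> rfl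

theorem Subst.cons_comp {Γ Δ Θ : Ctx S} {τ : S.Ty} (t : Term Δ τ) (s : Subst Δ Θ)
    (r : Subst Γ Δ) : (Subst.cons t s).comp r = Subst.cons (t.subst r) (s.comp r) := by
  funext σ x
  cases x <;> rfl

theorem Subst.comp_assoc {Γ Δ Θ Λ : Ctx S} (s : Subst Θ Λ) (r : Subst Δ Θ) (q : Subst Γ Δ) :
    (s.comp r).comp q = s.comp (r.comp q) := by
  funext σ x
  exact Term.subst_subst r q (s σ x)

theorem Subst.lift_comp {Γ Δ Θ : Ctx S} (τ : S.Ty) (s : Subst Δ Θ) (r : Subst Γ Δ) :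
    (s.lift τ).comp (r.lift τ) = (s.comp r).lift τ := by
  rw [Subst.lift_eq_cons τ s, Subst.cons_comp, Subst.lift_eq_cons τ (s.comp r),
    Subst.comp_assoc, Subst.comp_assoc]
  congr 2
  rw [Subst.lift_eq_cons]
  rfl

theorem Formula.subst_id {Γ : Ctx S} (A : Formula Γ) : A.subst (Subst.id Γ) = A := by
  induction A with
  | rel R ts => simp only [Formula.subst, Term.subst_id]
  | nrel R ts => simp only [Formula.subst, Term.subst_id]
  | top => rfl
  | bot => rfl
  | and A B ihA ihB => simp only [Formula.subst, ihA, ihB]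
  | or A B ihA ihB => simp only [Formula.subst, ihA, ihB]
  | all σ A ih => simp only [Formula.subst, Subst.lift_id, ih]
  | ex σ A ih => simp only [Formula.subst, Subst.lift_id, ih]

theorem Formula.subst_subst {Γ Δ Θ : Ctx S} (s : Subst Δ Θ) (r : Subst Γ Δ) (A : Formula Θ) :
    (A.subst s).subst r = A.subst (s.comp r) := by
  induction A generalizing Γ Δ with
  | rel R ts => simp only [Formula.subst, Term.subst_subst]
  | nrel R ts => simp only [Formula.subst, Term.subst_subst]
  | top => rfl
  | bot => rfl
  | and A B ihA ihB => simp only [Formula.subst, ihA, ihB]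
  | or A B ihA ihB => simp only [Formula.subst, ihA, ihB]
  | all σ A ih => simp only [Formula.subst, ih, Subst.lift_comp]
  | ex σ A ih => simp only [Formula.subst, ih, Subst.lift_comp]

theorem Formula.neg_neg {Γ : Ctx S} (A : Formula Γ) : A.neg.neg = A := by
  induction A <;> simp_all only [Formula.neg]

theorem Formula.neg_subst {Γ Δ : Ctx S} (s : Subst Γ Δ) (A : Formula Δ) :
    (A.subst s).neg = A.neg.subst s := by
  induction A generalizing Γ <;> simp_all only [Formula.neg, Formula.subst]

theorem Formula.subst_lift_inst {Γ Δ : Ctx S} {σ : S.Ty} (s : Subst Γ Δ) (A : Formula (σ :: Δ))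
    (t : Term Γ σ) : (A.subst (s.lift σ)).inst t = A.subst (Subst.cons t s) := by
  rw [Formula.inst, Formula.subst_subst, Subst.lift_eq_cons, Subst.cons_comp, Subst.comp_assoc]
  congr 2
  funext τ x
  exact Term.subst_id _

end SubstitutionLemmas

/-! ### Ortholattices -/

section Ortholattice

variable {α : Type u} [Ortholattice α]

theorem Ortholattice.compl_le_iff {a b : α} : aᶜ ≤ b ↔ bᶜ ≤ a := by
  constructor <;> intro h
  · simpa only [Ortholattice.compl_invol] using Ortholattice.compl_anti _ _ h
  · simpa only [Ortholattice.compl_invol] using Ortholattice.compl_anti _ _ h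

theorem Ortholattice.le_compl_iff {a b : α} : a ≤ bᶜ ↔ b ≤ aᶜ := by
  constructor <;> intro h
  · simpa only [Ortholattice.compl_invol] using Ortholattice.compl_anti _ _ h
  · simpa only [Ortholattice.compl_invol] using Ortholattice.compl_anti _ _ h

theorem Ortholattice.compl_inf (a b : α) : (a ⊓ b)ᶜ = aᶜ ⊔ bᶜ :=
  le_antisymm
    (compl_le_iff.2 (le_inf (compl_le_iff.2 le_sup_left) (compl_le_iff.2 le_sup_right)))
    (sup_le (compl_anti _ _ inf_le_left) (compl_anti _ _ inf_le_right))

theorem Ortholattice.compl_sup (a b : α) : (a ⊔ b)ᶜ = aᶜ ⊓ bᶜ := by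
  rw [← compl_invol (aᶜ ⊓ bᶜ), compl_inf, compl_invol, compl_invol]

theorem Ortholattice.compl_top : (⊤ : α)ᶜ = ⊥ := by
  simpa only [top_inf_eq] using inf_compl_self (⊤ : α)

theorem Ortholattice.compl_bot : (⊥ : α)ᶜ = ⊤ := by
  rw [← compl_top, compl_invol]

theorem Ortholattice.sup_compl_self (a : α) : a ⊔ aᶜ = ⊤ := by
  rw [← compl_invol (a ⊔ aᶜ), compl_sup, compl_invol, inf_comm, inf_compl_self, compl_bot]

end Ortholattice

/-! ### Soundness -/

section Soundness

variable {S : Signature.{u}} {C : Type v} [Category.{w} C] [CartesianMonoidalCategory C]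

section Pull

variable (P : Hyperdoctrine.{u} C) {X Y Z : C}

theorem pull_comp (f : X ⟶ Y) (g : Y ⟶ Z) (a : Fibre P Z) :
    pull P (f ≫ g) a = pull P f (pull P g a) :=
  congrArg (fun h => OrthoHom.toFun h a) (P.map_comp g.op f.op)

theorem pull_id (a : Fibre P X) : pull P (𝟙 X) a = a :=
  congrArg (fun h => OrthoHom.toFun h a) (P.map_id (op X))

theorem pull_inf (f : X ⟶ Y) (a b : Fibre P Y) : pull P f (a ⊓ b) = pull P f a ⊓ pull P f b :=
  OrthoHom.map_inf (P.map f.op) a b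

theorem pull_sup (f : X ⟶ Y) (a b : Fibre P Y) : pull P f (a ⊔ b) = pull P f a ⊔ pull P f b :=
  OrthoHom.map_sup (P.map f.op) a b

theorem pull_top (f : X ⟶ Y) : pull P f ⊤ = ⊤ := OrthoHom.map_top (P.map f.op)

theorem pull_bot (f : X ⟶ Y) : pull P f ⊥ = ⊥ := OrthoHom.map_bot (P.map f.op)

theorem pull_compl (f : X ⟶ Y) (a : Fibre P Y) : pull P f aᶜ = (pull P f a)ᶜ :=
  OrthoHom.map_compl (P.map f.op) a

theorem pull_mono (f : X ⟶ Y) {a b : Fibre P Y} (h : a ≤ b) : pull P f a ≤ pull P f b := by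
  rw [← inf_eq_left, ← pull_inf, inf_eq_left.2 h]

theorem Quantifiers.all_compl {P : Hyperdoctrine.{u} C} (Q : Quantifiers P)
    (a : Fibre P (X ⊗ Y)) : Q.all X Y aᶜ = (Q.ex X Y a)ᶜ := by
  refine le_antisymm ?_ ?_
  · rw [Ortholattice.le_compl_iff, Q.ex_adj X Y, pull_compl, Ortholattice.le_compl_iff,
      Q.all_adj X Y]
  · rw [← Q.all_adj X Y, pull_compl]
    exact Ortholattice.compl_anti _ _ ((Q.ex_adj X Y _ _).1 le_rfl)

theorem Quantifiers.ex_compl {P : Hyperdoctrine.{u} C} (Q : Quantifiers P)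
    (a : Fibre P (X ⊗ Y)) : Q.ex X Y aᶜ = (Q.all X Y a)ᶜ := by
  rw [← Ortholattice.compl_invol (Q.ex X Y aᶜ), ← Q.all_compl, Ortholattice.compl_invol]

end Pull

theorem tuple_varHom (ty : S.Ty → C) {X : C} {Δ : Ctx S} (g : ∀ σ : S.Ty, Var Δ σ → (X ⟶ ty σ))
    {σ : S.Ty} (x : Var Δ σ) : tuple ty Δ g ≫ varHom ty x = g σ x := by
  induction x with
  | zero => exact lift_fst _ _
  | succ x ih => exact (lift_snd_assoc _ _ _).trans (ih _)

theorem comp_tuple (ty : S.Ty → C) {X Y : C} (f : Y ⟶ X) {Δ : Ctx S}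
    (g : ∀ σ : S.Ty, Var Δ σ → (X ⟶ ty σ)) :
    f ≫ tuple ty Δ g = tuple ty Δ fun σ x => f ≫ g σ x := by
  induction Δ with
  | nil => exact toUnit_unique _ _
  | cons τ Δ ih => exact (comp_lift _ _ _).trans (congrArg (lift _) (ih _))

theorem tuple_comp_varHom (ty : S.Ty → C) {X : C} {Δ : Ctx S} (h : X ⟶ ctxObj ty Δ) :
    (tuple ty Δ fun _ x => h ≫ varHom ty x) = h := by
  induction Δ with
  | nil => exact toUnit_unique _ _
  | cons τ Δ ih =>
    have key (k : X ⟶ ty τ ⊗ ctxObj ty Δ) :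
        lift (k ≫ fst _ _) (tuple ty Δ fun _ x => k ≫ snd _ _ ≫ varHom ty x) = k := by
      have := ih (k ≫ snd _ _)
      simp only [Category.assoc] at this
      rw [this]
      ext <;> simp
    exact key h

namespace Interpretation

variable {P : Hyperdoctrine.{u} C}

/-- The arrow of the base interpreting a substitution. -/
def subst (I : Interpretation S P) {Γ Δ : Ctx S} (s : Subst Γ Δ) :
    ctxObj I.ty Γ ⟶ ctxObj I.ty Δ :=
  tuple I.ty Δ fun σ x => I.term (s σ x)

theorem term_subst (I : Interpretation S P) {Γ Δ : Ctx S} (s : Subst Γ Δ) {σ : S.Ty}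
    (t : Term Δ σ) : I.term (t.subst s) = I.subst s ≫ I.term t := by
  induction t with
  | var x => exact (tuple_varHom I.ty (fun σ x => I.term (s σ x)) x).symm
  | app f ts ih =>
    simp only [Term.subst, Interpretation.term, ih, ← comp_tuple, Category.assoc]

theorem subst_id (I : Interpretation S P) (Γ : Ctx S) : I.subst (Subst.id Γ) = 𝟙 _ := 
  (congrArg (tuple I.ty Γ) (funext fun _ => funext fun _ => (Category.id_comp _).symm)).trans
    (tuple_comp_varHom I.ty (𝟙 (ctxObj I.ty Γ)))

theorem subst_weaken (I : Interpretation S P) (σ : S.Ty) (Γ : Ctx S) :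
    I.subst (Subst.weaken σ Γ) = snd (I.ty σ) (ctxObj I.ty Γ) :=
  tuple_comp_varHom I.ty (snd (I.ty σ) (ctxObj I.ty Γ))

theorem subst_comp (I : Interpretation S P) {Γ Δ Θ : Ctx S} (s : Subst Δ Θ) (r : Subst Γ Δ) :
    I.subst (s.comp r) = I.subst r ≫ I.subst s := by
  rw [subst, subst.eq_def I s, comp_tuple]
  simp only [Subst.comp, term_subst]

theorem subst_cons (I : Interpretation S P) {Γ Δ : Ctx S} {σ : S.Ty} (t : Term Γ σ)
    (s : Subst Γ Δ) : I.subst (Subst.cons t s) = lift (I.term t) (I.subst s) := rfl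

theorem subst_lift (I : Interpretation S P) {Γ Δ : Ctx S} (σ : S.Ty) (s : Subst Γ Δ) :
    I.subst (s.lift σ) = I.ty σ ◁ I.subst s := by
  have h : lift (fst _ _) (snd _ _ ≫ I.subst s) = I.ty σ ◁ I.subst s := by
    ext <;> simp
  rw [Subst.lift_eq_cons, subst_cons, subst_comp, subst_weaken]
  exact h

variable (Q : Quantifiers P) (I : Interpretation S P)

/-- Substitution is interpreted by pullback; for the quantifiers this is the Beck-Chevalley
condition. -/
theorem formula_subst {Γ Δ : Ctx S} (s : Subst Γ Δ) (A : Formula Δ) :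
    I.formula Q (A.subst s) = pull P (I.subst s) (I.formula Q A) := by
  induction A generalizing Γ with
  | rel R ts =>
    simp only [Formula.subst, formula, term_subst, ← comp_tuple, pull_comp]
  | nrel R ts =>
    simp only [Formula.subst, formula, term_subst, ← comp_tuple, pull_comp, pull_compl]
  | top => exact (pull_top P _).symm
  | bot => exact (pull_bot P _).symm
  | and A B ihA ihB => simp only [Formula.subst, formula, ihA, ihB, pull_inf]
  | or A B ihA ihB => simp only [Formula.subst, formula, ihA, ihB, pull_sup]
  | all σ A ih =>
    refine Eq.trans (congrArg (Q.all _ _) ?_) (Q.all_beckChevalley _ _ _).symm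
    exact (ih _).trans (congrArg (fun f => pull P f _) (subst_lift I σ s))
  | ex σ A ih =>
    refine Eq.trans (congrArg (Q.ex _ _) ?_) (Q.ex_beckChevalley _ _ _).symm
    exact (ih _).trans (congrArg (fun f => pull P f _) (subst_lift I σ s))

theorem formula_inst {Γ : Ctx S} {σ : S.Ty} (A : Formula (σ :: Γ)) (t : Term Γ σ) :
    I.formula Q (A.inst t) = pull P (lift (I.term t) (𝟙 _)) (I.formula Q A) := by
  rw [Formula.inst, formula_subst, ← subst_id]
  rfl

theorem formula_neg {Γ : Ctx S} (A : Formula Γ) : I.formula Q A.neg = (I.formula Q A)ᶜ := by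
  induction A with
  | rel R ts => rfl
  | nrel R ts => exact (Ortholattice.compl_invol _).symm
  | top => exact Ortholattice.compl_top.symm
  | bot => exact Ortholattice.compl_bot.symm
  | and A B ihA ihB => simp only [Formula.neg, formula, ihA, ihB, Ortholattice.compl_inf]
  | or A B ihA ihB => simp only [Formula.neg, formula, ihA, ihB, Ortholattice.compl_sup]
  | all σ A ih => exact (congrArg (Q.ex _ _) ih).trans (Q.ex_compl _)
  | ex σ A ih => exact (congrArg (Q.all _ _) ih).trans (Q.all_compl _)

/-- The meet of the interpretations of a list of formulas. -/
def meet {Γ : Ctx S} (Φ : List (Formula Γ)) : Fibre P (ctxObj I.ty Γ) :=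
  Φ.foldr (fun A a => I.formula Q A ⊓ a) ⊤

/-- The join of the interpretations of a list of formulas. -/
def join {Γ : Ctx S} (Φ : List (Formula Γ)) : Fibre P (ctxObj I.ty Γ) :=
  Φ.foldr (fun A a => I.formula Q A ⊔ a) ⊥

variable {Q I}

theorem le_meet_iff {Γ : Ctx S} {Φ : List (Formula Γ)} {a : Fibre P (ctxObj I.ty Γ)} :
    a ≤ I.meet Q Φ ↔ ∀ A ∈ Φ, a ≤ I.formula Q A := by
  induction Φ with
  | nil => simp [meet]
  | cons A Φ ih =>
    rw [show I.meet Q (A :: Φ) = I.formula Q A ⊓ I.meet Q Φ from rfl, le_inf_iff, ih,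
      List.forall_mem_cons]

theorem join_le_iff {Γ : Ctx S} {Φ : List (Formula Γ)} {a : Fibre P (ctxObj I.ty Γ)} :
    I.join Q Φ ≤ a ↔ ∀ A ∈ Φ, I.formula Q A ≤ a := by
  induction Φ with
  | nil => simp [join]
  | cons A Φ ih =>
    rw [show I.join Q (A :: Φ) = I.formula Q A ⊔ I.join Q Φ from rfl, sup_le_iff, ih,
      List.forall_mem_cons]

theorem meet_anti {Γ : Ctx S} {Φ Φ' : List (Formula Γ)} (h : Φ ⊆ Φ') :
    I.meet Q Φ' ≤ I.meet Q Φ :=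
  le_meet_iff.2 fun _ hA => le_meet_iff.1 le_rfl _ (h hA)

theorem join_mono {Γ : Ctx S} {Φ Φ' : List (Formula Γ)} (h : Φ ⊆ Φ') :
    I.join Q Φ ≤ I.join Q Φ' :=
  join_le_iff.2 fun _ hA => join_le_iff.1 le_rfl _ (h hA)

theorem meet_cons {Γ : Ctx S} (A : Formula Γ) (Φ : List (Formula Γ)) :
    I.meet Q (A :: Φ) = I.formula Q A ⊓ I.meet Q Φ := rfl

theorem join_cons {Γ : Ctx S} (A : Formula Γ) (Φ : List (Formula Γ)) :
    I.join Q (A :: Φ) = I.formula Q A ⊔ I.join Q Φ := rfl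

theorem meet_nil {Γ : Ctx S} : I.meet Q ([] : List (Formula Γ)) = ⊤ := rfl

theorem join_nil {Γ : Ctx S} : I.join Q ([] : List (Formula Γ)) = ⊥ := rfl

theorem meet_singleton {Γ : Ctx S} (A : Formula Γ) : I.meet Q [A] = I.formula Q A :=
  inf_top_eq _

theorem join_singleton {Γ : Ctx S} (A : Formula Γ) : I.join Q [A] = I.formula Q A :=
  sup_bot_eq _

theorem meet_append {Γ : Ctx S} (Φ Φ' : List (Formula Γ)) :
    I.meet Q (Φ ++ Φ') = I.meet Q Φ ⊓ I.meet Q Φ' := by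
  induction Φ with
  | nil => exact (top_inf_eq _).symm
  | cons A Φ ih => rw [List.cons_append, meet_cons, ih, meet_cons, inf_assoc]

theorem join_append {Γ : Ctx S} (Φ Φ' : List (Formula Γ)) :
    I.join Q (Φ ++ Φ') = I.join Q Φ ⊔ I.join Q Φ' := by
  induction Φ with
  | nil => exact (bot_sup_eq _).symm
  | cons A Φ ih => rw [List.cons_append, join_cons, ih, join_cons, sup_assoc]

theorem meet_neg {Γ : Ctx S} (Φ : List (Formula Γ)) :
    I.meet Q (Φ.map Formula.neg) = (I.join Q Φ)ᶜ := by
  induction Φ with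
  | nil => exact Ortholattice.compl_bot.symm
  | cons A Φ ih => rw [List.map_cons, meet_cons, ih, join_cons, formula_neg,
      Ortholattice.compl_sup]

theorem join_neg {Γ : Ctx S} (Φ : List (Formula Γ)) :
    I.join Q (Φ.map Formula.neg) = (I.meet Q Φ)ᶜ := by
  induction Φ with
  | nil => exact Ortholattice.compl_top.symm
  | cons A Φ ih => rw [List.map_cons, meet_cons, join_cons, ih, formula_neg,
      Ortholattice.compl_inf]

theorem meet_subst {Γ Δ : Ctx S} (s : Subst Γ Δ) (Φ : List (Formula Δ)) :
    I.meet Q (Φ.map (Formula.subst s)) = pull P (I.subst s) (I.meet Q Φ) := by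
  induction Φ with
  | nil => exact (pull_top P _).symm
  | cons A Φ ih => rw [List.map_cons, meet_cons, ih, meet_cons, formula_subst, pull_inf]

theorem join_subst {Γ Δ : Ctx S} (s : Subst Γ Δ) (Φ : List (Formula Δ)) :
    I.join Q (Φ.map (Formula.subst s)) = pull P (I.subst s) (I.join Q Φ) := by
  induction Φ with
  | nil => exact (pull_bot P _).symm
  | cons A Φ ih => rw [List.map_cons, join_cons, ih, join_cons, formula_subst, pull_sup]

theorem meet_weaken {Γ : Ctx S} (σ : S.Ty) (Φ : List (Formula Γ)) :
    I.meet Q (Φ.map (Formula.weaken σ)) = pull P (snd (I.ty σ) (ctxObj I.ty Γ)) (I.meet Q Φ) :=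
  (meet_subst (Subst.weaken σ Γ) Φ).trans (congrArg (fun f => pull P f _) (subst_weaken I σ Γ))

theorem join_weaken {Γ : Ctx S} (σ : S.Ty) (Φ : List (Formula Γ)) :
    I.join Q (Φ.map (Formula.weaken σ)) = pull P (snd (I.ty σ) (ctxObj I.ty Γ)) (I.join Q Φ) :=
  (join_subst (Subst.weaken σ Γ) Φ).trans (congrArg (fun f => pull P f _) (subst_weaken I σ Γ))

theorem all_le_inst {Γ : Ctx S} {σ : S.Ty} (A : Formula (σ :: Γ)) (t : Term Γ σ) :
    I.formula Q (.all σ A) ≤ I.formula Q (A.inst t) := by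
  have h := pull_mono P (lift (I.term t) (𝟙 _))
    ((Q.all_adj (I.ty σ) (ctxObj I.ty Γ) (I.formula Q (.all σ A)) _).2 le_rfl)
  rwa [← pull_comp, lift_snd, pull_id, ← formula_inst] at h

theorem inst_le_ex {Γ : Ctx S} {σ : S.Ty} (A : Formula (σ :: Γ)) (t : Term Γ σ) :
    I.formula Q (A.inst t) ≤ I.formula Q (.ex σ A) := by
  have h := pull_mono P (lift (I.term t) (𝟙 _))
    ((Q.ex_adj (I.ty σ) (ctxObj I.ty Γ) _ (I.formula Q (.ex σ A))).1 le_rfl)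
  rwa [← pull_comp, lift_snd, pull_id, ← formula_inst] at h

end Interpretation

open Interpretation in
/-- Soundness holds in every hyperdoctrine with quantifiers. -/
theorem Derives.sound {P : Hyperdoctrine.{u} C} {Q : Quantifiers P} {I : Interpretation S P}
    {T : Set (Sequent S)} (hT : ∀ t ∈ T, I.Satisfies Q t) {Γ : Ctx S} {Φ Ψ : List (Formula Γ)}
    (h : Derives T Γ Φ Ψ) : I.meet Q Φ ≤ I.join Q Ψ := by
  induction h with
  | ofAxiom s hs => exact hT s hs
  | identity A => rw [meet_singleton, join_singleton]
  | substitution s _ ih => rw [meet_subst, join_subst]; exact pull_mono P _ ih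
  | cutL _ _ ih₁ ih₂ =>
    rw [join_singleton] at ih₁
    rw [meet_append]
    exact (inf_le_inf_right _ ih₁).trans ih₂
  | cutR _ _ ih₁ ih₂ =>
    rw [meet_singleton] at ih₂
    rw [join_append]
    exact ih₁.trans (sup_le_sup_right ih₂ _)
  | exchange hΦ hΨ _ ih => exact (meet_anti hΦ.subset).trans (ih.trans (join_mono hΨ.subset))
  | weakL A _ ih => exact inf_le_right.trans ih
  | weakR A _ ih => exact ih.trans le_sup_right
  | contrL _ ih => exact (meet_anti (by simp)).trans ih
  | contrR _ ih => exact ih.trans (join_mono (by simp))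
  | transferL _ ih =>
    rw [meet_append, meet_neg, join_nil, ← Ortholattice.inf_compl_self]
    exact inf_le_inf_right _ ih
  | transferR _ ih =>
    rw [join_append, join_neg, meet_nil, sup_comm, ← Ortholattice.sup_compl_self]
    exact sup_le_sup_right ih _
  | contraposition _ ih => rw [meet_neg, join_neg]; exact Ortholattice.compl_anti _ _ ih
  | topR Φ => rw [join_singleton]; exact le_top
  | botL Ψ => rw [meet_singleton]; exact bot_le
  | andL₁ B _ ih => rw [meet_singleton] at ih ⊢; exact inf_le_left.trans ih
  | andL₂ A _ ih => rw [meet_singleton] at ih ⊢; exact inf_le_right.trans ih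
  | andR _ _ ih₁ ih₂ => rw [join_singleton] at ih₁ ih₂ ⊢; exact le_inf ih₁ ih₂
  | orL _ _ ih₁ ih₂ => rw [meet_singleton] at ih₁ ih₂ ⊢; exact sup_le ih₁ ih₂
  | orR₁ B _ ih => rw [join_singleton] at ih ⊢; exact ih.trans le_sup_left
  | orR₂ A _ ih => rw [join_singleton] at ih ⊢; exact ih.trans le_sup_right
  | allL t _ ih => rw [meet_singleton] at ih ⊢; exact (all_le_inst _ t).trans ih
  | allR _ ih =>
    rw [join_singleton] at ih ⊢
    rw [meet_weaken] at ih
    exact (Q.all_adj _ _ _ _).1 ih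
  | exL _ ih =>
    rw [meet_singleton] at ih ⊢
    rw [join_weaken] at ih
    exact (Q.ex_adj _ _ _ _).2 ih
  | exR t _ ih => rw [join_singleton] at ih ⊢; exact ih.trans (inst_le_ex _ t)

end Soundness

/-! ### The complete ortholattice of closed sets of an orthogonality relation -/

/-- A set with a symmetric relation of orthogonality, such that a self-orthogonal point is
orthogonal to every point. -/
structure OrthoSpace (X : Type u) where
  rel : X → X → Prop
  symm : ∀ {x y}, rel x y → rel y x
  rel_of_self : ∀ {x}, rel x x → ∀ y, rel x y

namespace OrthoSpace

variable {X : Type u} (O : OrthoSpace X)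

/-- The set of all points orthogonal to every point of `U`. -/
def perp (U : Set X) : Set X := {x | ∀ y ∈ U, O.rel x y}

variable {O}

theorem subset_perp_iff {U V : Set X} : U ⊆ O.perp V ↔ V ⊆ O.perp U :=
  ⟨fun h _ hv _ hu => O.symm (h hu _ hv), fun h _ hu _ hv => O.symm (h hv _ hu)⟩

theorem perp_anti {U V : Set X} (h : U ⊆ V) : O.perp V ⊆ O.perp U :=
  fun _ hx y hy => hx y (h hy)

theorem subset_perp_perp (U : Set X) : U ⊆ O.perp (O.perp U) :=
  subset_perp_iff.1 Set.Subset.rfl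

theorem perp_perp_perp (U : Set X) : O.perp (O.perp (O.perp U)) = O.perp U :=
  Set.Subset.antisymm (perp_anti (subset_perp_perp U)) (subset_perp_perp _)

variable (O)

/-- The sets equal to their double orthocomplement, ordered by inclusion. -/
def Closed : Type u := {U : Set X // O.perp (O.perp U) = U}

instance : PartialOrder O.Closed :=
  inferInstanceAs (PartialOrder {U : Set X // O.perp (O.perp U) = U})

variable {O}

/-- The orthocomplement of an arbitrary set, as a closed set. -/
def Closed.ofPerp (U : Set X) : O.Closed := ⟨O.perp U, perp_perp_perp U⟩

theorem Closed.le_ofPerp_iff {U : O.Closed} {V : Set X} : U ≤ Closed.ofPerp V ↔ V ⊆ O.perp U.1 :=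
  subset_perp_iff

theorem Closed.ofPerp_le_iff {U : O.Closed} {V : Set X} :
    Closed.ofPerp V ≤ U ↔ O.perp U.1 ⊆ O.perp (O.perp V) := by
  refine ⟨fun h => perp_anti h, fun h => ?_⟩
  have := perp_anti (O := O) h
  rwa [perp_perp_perp, U.2] at this

instance : Ortholattice O.Closed where
  inf U V := ⟨U.1 ∩ V.1, by
    refine Set.Subset.antisymm (Set.subset_inter ?_ ?_) (subset_perp_perp _)
    · conv_rhs => rw [← U.2]
      exact perp_anti (perp_anti Set.inter_subset_left)
    · conv_rhs => rw [← V.2]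
      exact perp_anti (perp_anti Set.inter_subset_right)⟩
  inf_le_left _ _ := Set.inter_subset_left
  inf_le_right _ _ := Set.inter_subset_right
  le_inf _ _ _ h h' := Set.subset_inter h h'
  sup U V := Closed.ofPerp (O.perp U.1 ∩ O.perp V.1)
  le_sup_left U V := Closed.le_ofPerp_iff.2 Set.inter_subset_left
  le_sup_right U V := Closed.le_ofPerp_iff.2 Set.inter_subset_right
  sup_le U V W h h' := Closed.ofPerp_le_iff.2
    ((Set.subset_inter (perp_anti h) (perp_anti h')).trans (subset_perp_perp _))
  top := Closed.ofPerp ∅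
  le_top _ := Closed.le_ofPerp_iff.2 (Set.empty_subset _)
  bot := Closed.ofPerp Set.univ
  bot_le _ := Closed.ofPerp_le_iff.2 ((Set.subset_univ _).trans (subset_perp_perp _))
  compl U := Closed.ofPerp U.1
  compl_anti _ _ h := perp_anti h
  compl_invol U := Subtype.ext U.2
  inf_compl_self _ := Subtype.ext (Set.Subset.antisymm
    (fun _ hx y _ => O.rel_of_self (hx.2 _ hx.1) y)
    (Set.subset_inter (Closed.ofPerp_le_iff.2 ((Set.subset_univ _).trans (subset_perp_perp _)))
      (perp_anti (Set.subset_univ _))))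

theorem Closed.exists_isLUB (s : Set O.Closed) : ∃ a, IsLUB s a := by
  refine ⟨Closed.ofPerp (⋂ U ∈ s, O.perp U.1), fun U hU => ?_, fun V hV => ?_⟩
  · exact Closed.le_ofPerp_iff.2 (Set.biInter_subset_of_mem hU)
  · refine Closed.ofPerp_le_iff.2 (Set.Subset.trans ?_ (subset_perp_perp _))
    exact Set.subset_iInter₂ fun U hU => perp_anti (hV hU)

variable (O)

/-- The closed sets as a QL-algebra. -/
def algebra : QL.{u} := ⟨O.Closed⟩

theorem algebra_isComplete : O.algebra.IsComplete := fun s => Closed.exists_isLUB (O := O) s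

end OrthoSpace

/-! ### Sequents as single inequalities -/

section Calculus

variable {S : Signature.{u}} {T : Set (Sequent S)} {Γ : Ctx S}

theorem Derives.trans {A B C : Formula Γ} (h₁ : Derives T Γ [A] [B]) (h₂ : Derives T Γ [B] [C]) :
    Derives T Γ [A] [C] :=
  .cutL (Φ' := []) h₁ h₂

/-- The conjunction of a list of formulas. -/
def conj (Φ : List (Formula Γ)) : Formula Γ := Φ.foldr .and .top

/-- The disjunction of a list of formulas. -/
def disj (Φ : List (Formula Γ)) : Formula Γ := Φ.foldr .or .bot

theorem Derives.conj_elim {Φ : List (Formula Γ)} {A : Formula Γ} (h : A ∈ Φ) :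
    Derives T Γ [conj Φ] [A] := by
  induction Φ with
  | nil => cases h
  | cons B Φ ih =>
    rcases List.mem_cons.1 h with rfl | h
    · exact .andL₁ _ (.identity _)
    · exact .andL₂ _ (ih h)

theorem Derives.disj_intro {Φ : List (Formula Γ)} {A : Formula Γ} (h : A ∈ Φ) :
    Derives T Γ [A] [disj Φ] := by
  induction Φ with
  | nil => cases h
  | cons B Φ ih =>
    rcases List.mem_cons.1 h with rfl | h
    · exact .orR₁ _ (.identity _)
    · exact .orR₂ _ (ih h)

theorem Derives.weakL_append (Φ : List (Formula Γ)) {Φ' Ψ : List (Formula Γ)}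
    (h : Derives T Γ Φ' Ψ) : Derives T Γ (Φ' ++ Φ) Ψ := by
  refine .exchange List.perm_append_comm (.refl _) ?_
  induction Φ with
  | nil => exact h
  | cons A Φ ih => exact .weakL A ih

theorem Derives.weakR_append (Ψ : List (Formula Γ)) {Φ Ψ' : List (Formula Γ)}
    (h : Derives T Γ Φ Ψ') : Derives T Γ Φ (Ψ' ++ Ψ) := by
  refine .exchange (.refl _) List.perm_append_comm ?_
  induction Ψ with
  | nil => exact h
  | cons A Ψ ih => exact .weakR A ih

theorem Derives.conj_intro (Φ : List (Formula Γ)) : Derives T Γ Φ [conj Φ] := by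
  induction Φ with
  | nil => exact .topR _
  | cons A Φ ih => exact .andR (.weakL_append Φ (.identity A)) (.weakL A ih)

theorem Derives.disj_elim (Ψ : List (Formula Γ)) : Derives T Γ [disj Ψ] Ψ := by
  induction Ψ with
  | nil => exact .botL _
  | cons A Ψ ih => exact .orL (.weakR_append Ψ (.identity A)) (.weakR A ih)

/-- Several cuts on the left, followed by contraction of the cut premise. -/
theorem Derives.cutL_list {Φ Φ' Ψ : List (Formula Γ)} {B : Formula Γ}
    (hB : ∀ A ∈ Φ, Derives T Γ [B] [A]) (h : Derives T Γ (Φ ++ Φ') Ψ) :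
    Derives T Γ (B :: Φ') Ψ := by
  induction Φ generalizing Φ' with
  | nil => exact .weakL B h
  | cons A Φ ih =>
    rw [List.forall_mem_cons] at hB
    exact .contrL (ih hB.2 (.exchange List.perm_middle.symm (.refl _) (.cutL hB.1 h)))

/-- Several cuts on the right, followed by contraction of the cut conclusion. -/
theorem Derives.cutR_list {Φ Ψ Ψ' : List (Formula Γ)} {B : Formula Γ}
    (hB : ∀ A ∈ Ψ, Derives T Γ [A] [B]) (h : Derives T Γ Φ (Ψ ++ Ψ')) :
    Derives T Γ Φ (B :: Ψ') := by
  induction Ψ generalizing Ψ' with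
  | nil => exact .weakR B h
  | cons A Ψ ih =>
    rw [List.forall_mem_cons] at hB
    exact .contrR (ih hB.2 (.exchange (.refl _) List.perm_middle.symm (.cutR h hB.1)))

/-- Sequents amount to inequalities in the Lindenbaum algebra, in spite of the restricted contexts
of the operational rules, because the cut rules allow a context beside the cut formula. -/
theorem derives_iff_conj_disj {Φ Ψ : List (Formula Γ)} :
    Derives T Γ Φ Ψ ↔ Derives T Γ [conj Φ] [disj Ψ] := by
  constructor <;> intro h
  · rw [← List.append_nil Φ, ← List.append_nil Ψ] at h
    simpa using Derives.cutR_list (fun _ => .disj_intro) (Derives.cutL_list (fun _ => .conj_elim) h)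
  · have h₁ := Derives.cutL (Φ' := []) (.conj_intro Φ) h
    have h₂ := Derives.cutR (Ψ' := []) h₁ (.disj_elim Ψ)
    simpa using h₂

end Calculus

/-! ### Generic families -/

section Family

variable {S : Signature.{u}}

/-- A substitution instance of the context `Γ` together with countably many additional variables
of each type: in the context `Θ`, a term for each of these variables. -/
structure Assignment (Γ Θ : Ctx S) : Type u where
  vars : Subst Θ Γ
  fresh : ∀ σ : S.Ty, ℕ → Term Θ σ

variable {Γ Δ Θ : Ctx S}

/-- Substitution in all the terms of an assignment. -/
def Assignment.subst {Θ' : Ctx S} (κ : Assignment Γ Θ) (r : Subst Θ' Θ) : Assignment Γ Θ' where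
  vars := κ.vars.comp r
  fresh σ n := (κ.fresh σ n).subst r

/-- Two assignments agree, except possibly on the additional variables of index at least `N`. -/
def Assignment.Agree (N : ℕ) (κ κ' : Assignment Γ Θ) : Prop :=
  κ.vars = κ'.vars ∧ ∀ σ, ∀ n < N, κ.fresh σ n = κ'.fresh σ n

theorem Assignment.Agree.mono {M N : ℕ} (h : M ≤ N) {κ κ' : Assignment Γ Θ} (hκ : κ.Agree N κ') :
    κ.Agree M κ' :=
  ⟨hκ.1, fun σ n hn => hκ.2 σ n (hn.trans_le h)⟩

/-- A syntactic object (element of `F Θ` in the context `Θ`, with the action `act` of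
substitutions) whose free variables are among those of `Γ` and the additional variables of index
below some bound, which is the same for all types. It is encoded by its instances under all
assignments of terms to these variables, which commute with substitution. -/
@[ext]
structure Family (Γ : Ctx S) (F : Ctx S → Type u)
    (act : ∀ {Θ' Θ : Ctx S}, Subst Θ' Θ → F Θ → F Θ') : Type u where
  val : ∀ {Θ : Ctx S}, Assignment Γ Θ → F Θ
  val_subst : ∀ {Θ' Θ : Ctx S} (κ : Assignment Γ Θ) (r : Subst Θ' Θ),
    val (κ.subst r) = act r (val κ)
  bounded : ∃ N, ∀ {Θ : Ctx S} {κ κ' : Assignment Γ Θ}, κ.Agree N κ' → val κ = val κ'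

/-- Terms of type `σ` over `Γ` and the additional variables. -/
abbrev GTerm (Γ : Ctx S) (σ : S.Ty) : Type u :=
  Family Γ (fun Θ => Term Θ σ) fun r t => t.subst r

/-- Formulas over `Γ` and the additional variables. -/
abbrev GFormula (Γ : Ctx S) : Type u := Family Γ Formula Formula.subst

/-- Substitutions into `Δ` by terms over `Γ` and the additional variables. -/
abbrev GSubst (Γ Δ : Ctx S) : Type u := Family Γ (fun Θ => Subst Θ Δ) fun r s => s.comp r

/-- A variable of the context `Γ`. -/
def GTerm.var {σ : S.Ty} (x : Var Γ σ) : GTerm Γ σ where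
  val κ := κ.vars σ x
  val_subst _ _ := rfl
  bounded := ⟨0, fun h => by rw [h.1]⟩

/-- The additional variable of type `σ` and index `n`. -/
def GTerm.fresh (Γ : Ctx S) (σ : S.Ty) (n : ℕ) : GTerm Γ σ where
  val κ := κ.fresh σ n
  val_subst _ _ := rfl
  bounded := ⟨n + 1, fun h => h.2 σ n n.lt_succ_self⟩

/-- Contexts are finite, so the bounds for the components of a tuple of terms have a maximum. -/
theorem GTerm.exists_common_bound (g : ∀ σ : S.Ty, Var Δ σ → GTerm Γ σ) :
    ∃ N, ∀ {Θ : Ctx S} {κ κ' : Assignment Γ Θ}, κ.Agree N κ' →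
      ∀ (σ : S.Ty) (x : Var Δ σ), (g σ x).val κ = (g σ x).val κ' := by
  induction Δ with
  | nil => exact ⟨0, fun _ _ x => nomatch x⟩
  | cons τ Δ ih =>
    obtain ⟨M, hM⟩ := ih fun σ x => g σ x.succ
    obtain ⟨N, hN⟩ := (g τ .zero).bounded
    refine ⟨max M N, fun h σ x => ?_⟩
    cases x with
    | zero => exact hN (h.mono (le_max_right _ _))
    | succ x => exact hM (h.mono (le_max_left _ _)) σ x

/-- The substitution with given components. -/
def GSubst.of (g : ∀ σ : S.Ty, Var Δ σ → GTerm Γ σ) : GSubst Γ Δ where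
  val κ := fun σ x => (g σ x).val κ
  val_subst κ r := funext fun σ => funext fun x => (g σ x).val_subst κ r
  bounded := by
    obtain ⟨N, hN⟩ := GTerm.exists_common_bound g
    exact ⟨N, fun h => funext fun σ => funext fun x => hN h σ x⟩

/-- Application of a function symbol. -/
def GTerm.app (f : S.Fn) (s : GSubst Γ (S.dom f)) : GTerm Γ (S.cod f) where
  val κ := .app f (s.val κ)
  val_subst κ r := congrArg (Term.app f) (s.val_subst κ r)
  bounded := s.bounded.imp fun _ hN _ _ _ h => congrArg (Term.app f) (hN h)

/-- The instance of a formula in context `Δ` under a substitution. -/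
def Formula.at (A : Formula Δ) (s : GSubst Γ Δ) : GFormula Γ where
  val κ := A.subst (s.val κ)
  val_subst κ r := by rw [s.val_subst, Formula.subst_subst]
  bounded := s.bounded.imp fun _ hN _ _ _ h => congrArg (fun s => A.subst s) (hN h)

/-- The atomic formula with predicate symbol `R`. -/
def GFormula.rel (R : S.Rel) (s : GSubst Γ (S.arity R)) : GFormula Γ :=
  (Formula.rel R (Subst.id _)).at s

/-- The negation of a formula over `Γ` and the additional variables. -/
def GFormula.neg (a : GFormula Γ) : GFormula Γ where
  val κ := (a.val κ).neg
  val_subst κ r := by rw [a.val_subst, Formula.neg_subst]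
  bounded := a.bounded.imp fun _ hN _ _ _ h => congrArg Formula.neg (hN h)

theorem Formula.neg_at (A : Formula Δ) (s : GSubst Γ Δ) : A.neg.at s = (A.at s).neg := by
  simp only [GFormula.neg, Formula.at, Formula.neg_subst]

end Family

/-! ### The canonical algebra -/

section Canonical

variable {S : Signature.{u}} (T : Set (Sequent S)) (Γ : Ctx S)

/-- Orthogonality of formulas: one implies the negation of the other, for all instances. -/
def canonicalSpace : OrthoSpace (GFormula Γ) where
  rel a b := ∀ {Θ : Ctx S} (κ : Assignment Γ Θ), Derives T Θ [a.val κ] [(b.val κ).neg]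
  symm {a b} h Θ κ := by
    have := (h κ).contraposition
    simpa only [List.map_cons, List.map_nil, Formula.neg_neg] using this
  rel_of_self {a} h b Θ κ := by
    have := (h κ).transferL
    simp only [List.map_cons, List.map_nil, Formula.neg_neg, List.cons_append,
      List.nil_append] at this
    exact .weakR _ (.contrL this)

variable {Γ}

/-- The closed set of the formulas that imply `a`. -/
def down (a : GFormula Γ) : (canonicalSpace T Γ).Closed := .ofPerp {a.neg}

variable {T}

theorem mem_down {a b : GFormula Γ} : b ∈ (down T a).1 ↔
    ∀ {Θ : Ctx S} (κ : Assignment Γ Θ), Derives T Θ [b.val κ] [a.val κ] := by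
  have : b ∈ (down T a).1 ↔ (canonicalSpace T Γ).rel b a.neg :=
    ⟨fun h => h _ rfl, fun h c hc => (show c = a.neg from hc) ▸ h⟩
  simp only [this, canonicalSpace, GFormula.neg, Formula.neg_neg]

theorem down_le_down_iff {a b : GFormula Γ} : down T a ≤ down T b ↔
    ∀ {Θ : Ctx S} (κ : Assignment Γ Θ), Derives T Θ [a.val κ] [b.val κ] :=
  ⟨fun h => mem_down.1 (h (mem_down.2 fun _ => .identity _)),
    fun h _ hc => mem_down.2 fun κ => (mem_down.1 hc κ).trans (h κ)⟩

/-- The orthocomplement in the canonical algebra is the syntactic negation. -/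
theorem down_neg (a : GFormula Γ) : down T a.neg = (down T a)ᶜ := by
  refine le_antisymm ?_ ?_
  · intro b hb c hc
    refine (canonicalSpace T Γ).symm fun κ => (mem_down.1 hc κ).trans ?_
    have := (mem_down.1 hb κ).contraposition
    simpa only [GFormula.neg, List.map_cons, List.map_nil, Formula.neg_neg] using this
  · intro b hb
    exact mem_down.2 fun κ => hb a (mem_down.2 fun _ => .identity _) κ

variable {Δ : Ctx S}

theorem down_top (s : GSubst Γ Δ) : down T (Formula.top.at s) = ⊤ :=
  top_le_iff.1 fun _ _ => mem_down.2 fun _ => .topR _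

theorem down_and (A B : Formula Δ) (s : GSubst Γ Δ) :
    down T ((Formula.and A B).at s) = down T (A.at s) ⊓ down T (B.at s) := by
  refine le_antisymm (le_inf ?_ ?_) ?_
  · exact down_le_down_iff.2 fun κ => .andL₁ _ (.identity _)
  · exact down_le_down_iff.2 fun κ => .andL₂ _ (.identity _)
  · intro b hb
    exact mem_down.2 fun κ => .andR (mem_down.1 hb.1 κ) (mem_down.1 hb.2 κ)

theorem down_neg_at (A : Formula Δ) (s : GSubst Γ Δ) :
    down T (A.neg.at s) = (down T (A.at s))ᶜ := by
  rw [Formula.neg_at, down_neg]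

theorem down_bot (s : GSubst Γ Δ) : down T (Formula.bot.at s) = ⊥ := by
  rw [show (Formula.bot : Formula Δ) = Formula.top.neg from rfl, down_neg_at, down_top,
    Ortholattice.compl_top]

theorem down_or (A B : Formula Δ) (s : GSubst Γ Δ) :
    down T ((Formula.or A B).at s) = down T (A.at s) ⊔ down T (B.at s) := by
  rw [← Formula.neg_neg (Formula.or A B), down_neg_at, Formula.neg, down_and, down_neg_at,
    down_neg_at, Ortholattice.compl_inf, Ortholattice.compl_invol, Ortholattice.compl_invol]

open Classical in
/-- A formula that implies all instances of `A` implies `∀ A`, because it implies the instance at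
an additional variable occurring neither in it nor in the other parameters of `A`. Here
`p d` is the extension of the parameters `s` by `d`. -/
theorem isGLB_down_all {σ : S.Ty} (A : Formula (σ :: Δ)) (s : GSubst Γ Δ)
    (p : GTerm Γ σ → GSubst Γ (σ :: Δ))
    (hp : ∀ (d : GTerm Γ σ) {Θ : Ctx S} (κ : Assignment Γ Θ),
      (p d).val κ = Subst.cons (d.val κ) (s.val κ)) :
    IsGLB (Set.range fun d => down T (A.at (p d))) (down T ((Formula.all σ A).at s)) := by
  constructor
  · rintro _ ⟨d, rfl⟩
    refine down_le_down_iff.2 fun κ => ?_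
    simp only [Formula.at, Formula.subst, hp]
    rw [← Formula.subst_lift_inst]
    exact .allL _ (.identity _)
  · intro W hW b hb
    refine mem_down.2 fun {Θ} κ => ?_
    obtain ⟨M, hM⟩ := b.bounded
    obtain ⟨N, hN⟩ := s.bounded
    let n := max M N
    let κ₁ := κ.subst (Subst.weaken σ Θ)
    -- The variable of index `n` is sent to the variable that `∀` binds.
    let κ₂ : Assignment Γ (σ :: Θ) :=
      { vars := κ₁.vars
        fresh := Function.update κ₁.fresh σ (Function.update (κ₁.fresh σ) n (.var .zero)) }
    have agree : κ₂.Agree n κ₁ := by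
      refine ⟨rfl, fun τ m hm => ?_⟩
      by_cases h : τ = σ
      · subst h
        simp only [κ₂, Function.update_self, Function.update_of_ne hm.ne]
      · simp only [κ₂, Function.update_of_ne h]
    have h := mem_down.1 (hW ⟨GTerm.fresh Γ σ n, rfl⟩ hb) κ₂
    have hn : (GTerm.fresh Γ σ n).val κ₂ = .var .zero := by
      simp only [GTerm.fresh, κ₂, Function.update_self]
    simp only [Formula.at, hp, hn] at h
    rw [hM (agree.mono (le_max_left _ _)), hN (agree.mono (le_max_right _ _)), b.val_subst,
      s.val_subst, ← Subst.lift_eq_cons] at h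
    exact .allR h

end Canonical

/-! ### The canonical interpretation -/

section Completeness

theorem homQuantifiers_isGLB {Ω : QL.{u}} (h : Ω.IsComplete) {X Y : Type u} (v : X × Y → Ω)
    (y : Y) : IsGLB (Set.range fun x => v (x, y)) ((homQuantifiers Ω h).all X Y v y) :=
  (h.exists_isGLB (Set.range fun x => v (x, y))).choose_spec

variable {S : Signature.{u}} (T : Set (Sequent S)) (Γ : Ctx S)

variable {Γ} in
/-- The substitution whose components are those of an element of a product of sets of terms. -/
def env {Δ : Ctx S} (e : ctxObj (C := Type u) (GTerm Γ) Δ) : GSubst Γ Δ :=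
  GSubst.of fun _ x => varHom (C := Type u) (GTerm Γ) x e

/-- Types are interpreted as sets of terms, and atomic formulas by the formulas implying them. -/
def canonical : Interpretation S (homDoctrine (canonicalSpace T Γ).algebra) where
  ty := GTerm Γ
  fn f := TypeCat.ofHom fun e => GTerm.app f (env e)
  rel R := fun e => down T (GFormula.rel R (env e))

variable {T Γ}

theorem env_tuple {X : Type u} {Δ : Ctx S} (g : ∀ σ : S.Ty, Var Δ σ → (X ⟶ GTerm Γ σ)) (x : X) :
    env (tuple (C := Type u) (GTerm Γ) Δ g x) = GSubst.of fun σ y => g σ y x :=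
  congrArg GSubst.of <| funext fun σ => funext fun y =>
    congrArg (fun h : X ⟶ GTerm Γ σ => h x) (tuple_varHom (C := Type u) (GTerm Γ) g y)

/-- The interpretation of a term at given parameters is the corresponding instance of the term. -/
theorem canonical_term {Δ Θ : Ctx S} (e : ctxObj (C := Type u) (GTerm Γ) Δ) {σ : S.Ty}
    (t : Term Δ σ) (κ : Assignment Γ Θ) :
    Family.val ((canonical T Γ).term t e : GTerm Γ σ) κ = t.subst ((env e).val κ) := by
  induction t with
  | var x => rfl
  | app f ts ih =>
    refine congrArg (Term.app f) ?_
    have h := env_tuple (fun τ x => (canonical T Γ).term (ts τ x)) e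
    exact (congrArg (fun s => Family.val s κ) h).trans (funext fun τ => funext fun x => ih τ x)

theorem canonical_rel {Δ : Ctx S} (e : ctxObj (C := Type u) (GTerm Γ) Δ) (R : S.Rel)
    (ts : Subst Δ (S.arity R)) :
    GFormula.rel R (env (tuple (C := Type u) (GTerm Γ) (S.arity R)
      (fun τ x => (canonical T Γ).term (ts τ x)) e)) = (Formula.rel R ts).at (env e) := by
  refine (congrArg (GFormula.rel R) (env_tuple _ e)).trans ?_
  have h : ∀ {Θ : Ctx S} (κ : Assignment Γ Θ),
      (GSubst.of fun σ y => (canonical T Γ).term (ts σ y) e).val κ = ts.comp ((env e).val κ) :=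
    fun κ => funext fun τ => funext fun x => canonical_term e (ts τ x) κ
  exact Family.ext (funext fun _ => funext fun κ => congrArg (Formula.rel R) (h κ))

/-- The universal step of `canonical_formula`, for an arbitrary function `v` in place of the
interpretation of `A`, so that it applies to negations as well. -/
theorem canonical_all {Δ : Ctx S} {σ : S.Ty} (A : Formula (σ :: Δ))
    (v : GTerm Γ σ × ctxObj (C := Type u) (GTerm Γ) Δ → (canonicalSpace T Γ).algebra)
    (hv : ∀ e : ctxObj (C := Type u) (GTerm Γ) (σ :: Δ), v e = down T (A.at (env e)))
    (e : ctxObj (C := Type u) (GTerm Γ) Δ) :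
    (homQuantifiers _ (canonicalSpace T Γ).algebra_isComplete).all (GTerm Γ σ)
      (ctxObj (C := Type u) (GTerm Γ) Δ) v e = down T ((Formula.all σ A).at (env e)) := by
  refine (homQuantifiers_isGLB _ v e).unique ?_
  have h := isGLB_down_all (T := T) A (env e)
    (fun d => env ((d, e) : ctxObj (C := Type u) (GTerm Γ) (σ :: Δ)))
    fun d Θ κ => funext fun τ => funext fun x => by cases x <;> rfl
  have hr : (fun d => v (d, e)) = fun d => down T (A.at (env ((d, e) :
      ctxObj (C := Type u) (GTerm Γ) (σ :: Δ)))) := funext fun d => hv (d, e)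
  rw [hr]
  exact h

/-- The interpretation of `A` at given parameters is the closed set of the formulas that imply
the corresponding instance of `A`. -/
theorem canonical_formula {Δ : Ctx S} (A : Formula Δ) (e : ctxObj (C := Type u) (GTerm Γ) Δ) :
    (canonical T Γ).formula (homQuantifiers _ (canonicalSpace T Γ).algebra_isComplete) A e =
      down T (A.at (env e)) := by
  induction A with
  | rel R ts => exact congrArg (down T) (canonical_rel e R ts)
  | nrel R ts =>
    refine Eq.trans ?_ (down_neg_at (Formula.rel R ts) (env e)).symm
    exact congrArg (fun a => (down T a)ᶜ) (canonical_rel e R ts)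
  | top => exact (down_top _).symm
  | bot => exact (down_bot _).symm
  | and A B ihA ihB => exact (congrArg₂ (· ⊓ ·) (ihA e) (ihB e)).trans (down_and A B _).symm
  | or A B ihA ihB => exact (congrArg₂ (· ⊔ ·) (ihA e) (ihB e)).trans (down_or A B _).symm
  | all σ A ih => exact canonical_all A _ ih e
  | ex σ A ih =>
    rw [← Formula.neg_neg (.ex σ A), Interpretation.formula_neg, down_neg_at]
    refine congrArg Compl.compl ?_
    refine canonical_all A.neg _ (fun e => ?_) e
    rw [Interpretation.formula_neg, down_neg_at, ← ih]
    rfl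

theorem Interpretation.formula_conj {C : Type v} [Category.{w} C] [CartesianMonoidalCategory C]
    {P : Hyperdoctrine.{u} C} (Q : Quantifiers P) (I : Interpretation S P) {Δ : Ctx S}
    (Φ : List (Formula Δ)) : I.formula Q (conj Φ) = I.meet Q Φ := by
  induction Φ with
  | nil => rfl
  | cons A Φ ih => exact congrArg (I.formula Q A ⊓ ·) ih

theorem Interpretation.formula_disj {C : Type v} [Category.{w} C] [CartesianMonoidalCategory C]
    {P : Hyperdoctrine.{u} C} (Q : Quantifiers P) (I : Interpretation S P) {Δ : Ctx S}
    (Φ : List (Formula Δ)) : I.formula Q (disj Φ) = I.join Q Φ := by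
  induction Φ with
  | nil => rfl
  | cons A Φ ih => exact congrArg (I.formula Q A ⊔ ·) ih

/-- A sequent holds in the canonical interpretation if and only if all its instances are
derivable. -/
theorem canonical_satisfies_iff {s : Sequent S} :
    (canonical T Γ).Satisfies (homQuantifiers _ (canonicalSpace T Γ).algebra_isComplete) s ↔
      ∀ (e : ctxObj (C := Type u) (GTerm Γ) s.ctx) {Θ : Ctx S} (κ : Assignment Γ Θ),
        Derives T Θ [(conj s.ant).subst ((env e).val κ)] [(disj s.suc).subst ((env e).val κ)] := by
  have h : (canonical T Γ).Satisfies
      (homQuantifiers _ (canonicalSpace T Γ).algebra_isComplete) s ↔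
      ∀ e : ctxObj (C := Type u) (GTerm Γ) s.ctx,
        down T ((conj s.ant).at (env e)) ≤ down T ((disj s.suc).at (env e)) := by
    simp only [← canonical_formula, Interpretation.formula_conj, Interpretation.formula_disj]
    rfl
  rw [h]
  exact forall_congr' fun e => down_le_down_iff

/-- The variables of `Γ` as an element of the interpretation of `Γ`. -/
def genericEnv (Γ : Ctx S) : ctxObj (C := Type u) (GTerm Γ) Γ :=
  tuple (C := Type u) (X := PUnit) (GTerm Γ) Γ (fun _ x => TypeCat.ofHom fun _ => GTerm.var x) ⟨⟩

theorem env_genericEnv {Θ : Ctx S} (κ : Assignment Γ Θ) : (env (genericEnv Γ)).val κ = κ.vars :=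
  congrArg (fun s => Family.val s κ) (env_tuple _ _)

end Completeness

end TFSq

theorem mainTheorem3 (S : TFSq.Signature.{u}) (T : Set (TFSq.Sequent S)) (s : TFSq.Sequent S) :
    (TFSq.Derivable T s → TFSq.SetValid T s) ∧
      ((∀ σ : S.Ty, Nonempty (TFSq.Term s.ctx σ)) → TFSq.SetValid T s → TFSq.Derivable T s) := by
  refine ⟨fun h Ω hΩ I hT => h.sound hT, fun ht hs => ?_⟩
  have valid := hs _ (TFSq.canonicalSpace T s.ctx).algebra_isComplete (TFSq.canonical T s.ctx)
    fun t h => TFSq.canonical_satisfies_iff.2 fun e _ κ =>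
      (TFSq.derives_iff_conj_disj.1 (.ofAxiom t h)).substitution _
  -- The variables of the context are sent to themselves, the additional ones to arbitrary terms.
  have h := TFSq.canonical_satisfies_iff.1 valid (TFSq.genericEnv s.ctx)
    ⟨TFSq.Subst.id s.ctx, fun σ _ => (ht σ).some⟩
  rw [TFSq.env_genericEnv, TFSq.Formula.subst_id, TFSq.Formula.subst_id] at h
  exact TFSq.derives_iff_conj_disj.2 h
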